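/- Let $n,m\ge 1$ be integers. Divide the indices $0,1,2,\dots$ from left to right into consecutive bins of sizes $n,m,n,m,\dots$. Given an increasing sequence of positive integers $\{a_x\}_{x\ge 0}$, an $(n,m)$-bin legal decomposition of an integer $z\ge 0$ is an expression of $z$ as a sum of terms of the sequence in which no two summands have indices in the same bin or in adjacent bins (the empty sum is the legal decomposition of $0$). The $(n,m)$-bin sequence is the unique increasing sequence of positive integers $\{a_x\}_{x\ge0}$ for which every positive integer has a unique $(n,m)$-bin legal decomposition. Theorem (Gaussian Behavior of Summands). Let $\{a_x\}_{x\ge 0}$ be the $(n,m)$-bin sequence, and let the random variable $Y_k$ denote the number of summands in the $(n,m)$-bin legal decomposition of an integer chosen uniformly at random from $[0,a_{(n+m)k})$. Let $\mu_k$ and $\sigma_k^2$ be the mean and the variance of $Y_k$, and let $Y_k'=(Y_k-\mu_k)/\sigma_k$. Put $\beta=\sqrt{(1+m+n)^2-4mn}$ and $$C=\frac{\beta-1}{\beta},\qquad C'=\frac{(m+n)(1+m+n)-4mn}{\beta^3}.$$ Then $C>0$ and $C'>0$, and as $k\to\infty$, with $n$ and $m$ fixed, $$\mu_k=Ck+O(1),\qquad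 \sigma_k^2=C'k+O(1).$$ Moreover, $Y_k'$ converges in distribution to the standard normal distribution as $k\to\infty$. -/

import Mathlib

open MeasureTheory ProbabilityTheory Filter Asymptotics

/-- The indices `0, 1, 2, …` are divided from left to right into consecutive bins of sizes
`n, m, n, m, …`. `binNumber n m x` is the number (starting from `0`) of the bin that contains
the index `x`: writing `x = (n + m) * q + i` with `0 ≤ i < n + m`, it is `2 * q` if `i < n`
and `2 * q + 1` if `n ≤ i`. -/
def binNumber (n m x : ℕ) : ℕ :=
  2 * (x / (n + m)) + if x % (n + m) < n then 0 else 1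

/-- `S` is the set of indices of the summands of an `(n, m)`-bin legal decomposition of `z` with
respect to the sequence `a`: the summands add up to `z`, and no two of them lie in the same bin or
in adjacent bins. (A term cannot be used twice, since it lies in the same bin as itself.) -/
structure IsLegalDecomposition (n m : ℕ) (a : ℕ → ℕ) (z : ℕ) (S : Finset ℕ) : Prop where
  sum_eq : ∑ i ∈ S, a i = z
  not_same_bin : ∀ i ∈ S, ∀ j ∈ S, i ≠ j → binNumber n m i ≠ binNumber n m j
  not_adjacent_bin : ∀ i ∈ S, ∀ j ∈ S, binNumber n m i + 1 ≠ binNumber n m j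

/-- `a` is the `(n, m)`-bin sequence: an increasing sequence of positive integers such that every
positive integer has exactly one `(n, m)`-bin legal decomposition. -/
structure IsBinSequence (n m : ℕ) (a : ℕ → ℕ) : Prop where
  strictMono : StrictMono a
  pos : ∀ x, 0 < a x
  existsUnique_legal : ∀ z, 0 < z → ∃! S : Finset ℕ, IsLegalDecomposition n m a z S

open Classical in
/-- The number of summands in the `(n, m)`-bin legal decomposition of `z`
(with value `0` if `z` has no legal decomposition). -/
noncomputable def numSummands (n m : ℕ) (a : ℕ → ℕ) (z : ℕ) : ℕ :=
  if h : ∃ S : Finset ℕ, IsLegalDecomposition n m a z S then h.choose.card else 0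

/-- The uniform distribution on the integers in `[0, a_{(n+m)k})`. -/
noncomputable def uniformLaw (n m : ℕ) (a : ℕ → ℕ) (k : ℕ) : Measure ℕ :=
  uniformOn (Set.Iio (a ((n + m) * k)))

theorem IsBinSequence.isProbabilityMeasure_uniformLaw {n m : ℕ} {a : ℕ → ℕ}
    (ha : IsBinSequence n m a) (k : ℕ) : IsProbabilityMeasure (uniformLaw n m a k) :=
  isProbabilityMeasure_uniformOn (Set.finite_Iio _) ⟨0, ha.pos _⟩

/-- The random variable `Y`: the number of summands, as a real-valued function of the integer. -/
noncomputable def summandVar (n m : ℕ) (a : ℕ → ℕ) (z : ℕ) : ℝ :=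
  (numSummands n m a z : ℝ)

/-- The mean of the number of summands of an integer chosen uniformly from `[0, a_{(n+m)k})`. -/
noncomputable def summandMean (n m : ℕ) (a : ℕ → ℕ) (k : ℕ) : ℝ :=
  ∫ z, summandVar n m a z ∂(uniformLaw n m a k)

/-- The variance of the number of summands of an integer chosen uniformly from
`[0, a_{(n+m)k})`. -/
noncomputable def summandVariance (n m : ℕ) (a : ℕ → ℕ) (k : ℕ) : ℝ :=
  variance (summandVar n m a) (uniformLaw n m a k)

/-- The normalized number of summands: subtract the mean, divide by the standard deviation. -/
noncomputable def normalizedSummandVar (n m : ℕ) (a : ℕ → ℕ) (k : ℕ) (z : ℕ) : ℝ :=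
  (summandVar n m a z - summandMean n m a k) / √(summandVariance n m a k)

/-- `β = √((1 + m + n)² - 4mn)`. -/
noncomputable def binBeta (n m : ℕ) : ℝ :=
  √((1 + (m : ℝ) + (n : ℝ)) ^ 2 - 4 * (m : ℝ) * (n : ℝ))

/-- `C = (β - 1) / β`. -/
noncomputable def meanConst (n m : ℕ) : ℝ :=
  (binBeta n m - 1) / binBeta n m

/-- `C' = ((m + n)(1 + m + n) - 4mn) / β³`. -/
noncomputable def varianceConst (n m : ℕ) : ℝ :=
  (((m : ℝ) + (n : ℝ)) * (1 + (m : ℝ) + (n : ℝ)) - 4 * (m : ℝ) * (n : ℝ)) / binBeta n m ^ 3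

/-! Summation maps the legal sets of indices below `x` bijectively onto the integers in `[0, a x)`
(`image_sum_legalSets`, `sum_injOn`). Hence `Y_k` is the cardinality of a uniformly random legal
subset of the first `2k` bins, and everything is encoded in W_k(t) = ∑ t^|S| (`legalGenFun`), which
satisfies W_{q+2} = (1 + (n+m)t) W_{q+1} - nm t² W_q. This recursion is solved in two ways.

Chebyshev polynomials of the second kind give W_k(t) = ∏ (1 + c_j t) with real c_j ≥ 0
(`legalGenFun_eq_prod`). So `Y_k` has the law of a sum of independent Bernoulli variables with
parameters c_j / (1 + c_j), and normality follows by comparing characteristic functions once the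
variance grows linearly.

The Binet form (x - y) W_k = x^(k+1) - y^(k+1), with x and y the characteristic roots, yields the
constants. With M = t W_k'/W_k (`tiltedMean`), the mean is M(1) and the variance is M'(1). Since y/x
< 1, the contribution of y is exponentially small, leaving terms linear in k plus O(1). -/

/-! ### Bins and legal sets of indices -/

/-- The first index of the bin with number `b`. -/
def binStart (n m b : ℕ) : ℕ :=
  (n + m) * (b / 2) + if b % 2 = 0 then 0 else n

theorem lt_binStart_iff {n m : ℕ} (hn : 1 ≤ n) (i b : ℕ) :
    i < binStart n m b ↔ binNumber n m i < b := by
  unfold binStart binNumber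
  have hpos : 0 < n + m := by omega
  have hi := Nat.div_add_mod i (n + m)
  have hlt := Nat.mod_lt i hpos
  set q := i / (n + m)
  set r := i % (n + m)
  rcases lt_trichotomy q (b / 2) with h | h | h
  · have h1 : (n + m) * (q + 1) ≤ (n + m) * (b / 2) := Nat.mul_le_mul_left _ h
    rw [Nat.mul_add] at h1
    split_ifs <;> omega
  · rw [← h]
    split_ifs <;> omega
  · have h1 : (n + m) * (b / 2 + 1) ≤ (n + m) * q := Nat.mul_le_mul_left _ h
    rw [Nat.mul_add] at h1
    split_ifs <;> omega

theorem binStart_two_mul (n m q : ℕ) : binStart n m (2 * q) = (n + m) * q := by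
  simp [binStart]

theorem binStart_two_mul_add_one (n m q : ℕ) :
    binStart n m (2 * q + 1) = (n + m) * q + n := by
  simp [binStart, Nat.add_mod]
  left; omega

theorem binNumber_mono {n m : ℕ} (hn : 1 ≤ n) : Monotone (binNumber n m) := by
  intro i j hij
  by_contra! h
  exact absurd ((lt_binStart_iff hn i _).1 (hij.trans_lt ((lt_binStart_iff hn j _).2 h)))
    (lt_irrefl _)

/-- No two elements of `S` lie in the same bin or in adjacent bins. -/
structure IsLegalSet (n m : ℕ) (S : Finset ℕ) : Prop where
  not_same_bin : ∀ i ∈ S, ∀ j ∈ S, i ≠ j → binNumber n m i ≠ binNumber n m j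
  not_adjacent_bin : ∀ i ∈ S, ∀ j ∈ S, binNumber n m i + 1 ≠ binNumber n m j

theorem isLegalDecomposition_iff {n m : ℕ} {a : ℕ → ℕ} {z : ℕ} {S : Finset ℕ} :
    IsLegalDecomposition n m a z S ↔ IsLegalSet n m S ∧ ∑ i ∈ S, a i = z :=
  ⟨fun h => ⟨⟨h.2, h.3⟩, h.1⟩, fun h => ⟨h.2, h.1.1, h.1.2⟩⟩

theorem IsLegalSet.mono {n m : ℕ} {S T : Finset ℕ} (hT : IsLegalSet n m T) (h : S ⊆ T) :
    IsLegalSet n m S :=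
  ⟨fun i hi j hj => hT.1 i (h hi) j (h hj), fun i hi j hj => hT.2 i (h hi) j (h hj)⟩

theorem isLegalSet_empty (n m : ℕ) : IsLegalSet n m ∅ := ⟨by simp, by simp⟩

/-- A new largest index forces the others at least two bins below it. The truncated subtraction is
harmless: for `x` in bin 0 or 1 the bound is 0, so `S` must be empty, as it should. -/
theorem isLegalSet_insert_iff {n m : ℕ} (hn : 1 ≤ n) {x : ℕ} {S : Finset ℕ}
    (hS : ∀ i ∈ S, i < x) :
    IsLegalSet n m (insert x S) ↔
      IsLegalSet n m S ∧ ∀ i ∈ S, i < binStart n m (binNumber n m x - 1) := by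
  constructor
  · refine fun h => ⟨h.mono (Finset.subset_insert _ _), fun i hi => ?_⟩
    rw [lt_binStart_iff hn]
    have h1 := h.1 i (by simp [hi]) x (by simp) (hS i hi).ne
    have h2 := h.2 i (by simp [hi]) x (by simp)
    have h3 := binNumber_mono (m := m) hn (hS i hi).le
    omega
  · rintro ⟨h, hlt⟩
    simp_rw [lt_binStart_iff hn] at hlt
    constructor
    · intro i hi j hj hij
      rw [Finset.mem_insert] at hi hj
      rcases hi with rfl | hi <;> rcases hj with rfl | hj
      · exact absurd rfl hij
      · have := hlt j hj; omega
      · have := hlt i hi; omega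
      · exact h.1 i hi j hj hij
    · intro i hi j hj
      rw [Finset.mem_insert] at hi hj
      rcases hi with rfl | hi <;> rcases hj with rfl | hj
      · omega
      · have := hlt j hj; omega
      · have := hlt i hi; omega
      · exact h.2 i hi j hj

open Classical in
/-- The legal sets of indices smaller than `N`. -/
noncomputable def legalSets (n m N : ℕ) : Finset (Finset ℕ) :=
  (Finset.range N).powerset.filter (IsLegalSet n m)

theorem mem_legalSets {n m N : ℕ} {S : Finset ℕ} :
    S ∈ legalSets n m N ↔ (∀ i ∈ S, i < N) ∧ IsLegalSet n m S := by
  simp [legalSets, Finset.subset_iff]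

theorem legalSets_zero (n m : ℕ) : legalSets n m 0 = {∅} := by
  ext S
  rw [mem_legalSets, Finset.mem_singleton]
  constructor
  · exact fun h => Finset.eq_empty_of_forall_notMem fun i hi => absurd (h.1 i hi) (by simp)
  · rintro rfl
    exact ⟨by simp, isLegalSet_empty n m⟩

theorem binStart_binNumber_sub_one_le {n m : ℕ} (hn : 1 ≤ n) (x : ℕ) :
    binStart n m (binNumber n m x - 1) ≤ x := by
  by_contra! h
  rw [lt_binStart_iff hn] at h
  omega

theorem legalSets_succ {n m : ℕ} (hn : 1 ≤ n) (x : ℕ) :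
    legalSets n m (x + 1) = legalSets n m x ∪
      (legalSets n m (binStart n m (binNumber n m x - 1))).image (insert x) := by
  ext S
  rw [Finset.mem_union, Finset.mem_image, mem_legalSets, mem_legalSets]
  have hle := binStart_binNumber_sub_one_le (m := m) hn x
  constructor
  · rintro ⟨hlt, hS⟩
    by_cases hx : x ∈ S
    · right
      have hS' : ∀ i ∈ S.erase x, i < x := fun i hi => by
        have h1 := hlt i (Finset.mem_of_mem_erase hi)
        have h2 := Finset.ne_of_mem_erase hi
        omega
      refine ⟨S.erase x, ?_, Finset.insert_erase hx⟩
      rw [← Finset.insert_erase hx, isLegalSet_insert_iff hn hS'] at hS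
      exact mem_legalSets.2 ⟨hS.2, hS.1⟩
    · left
      refine ⟨fun i hi => ?_, hS⟩
      have h1 := hlt i hi
      have h2 : i ≠ x := fun h => hx (h ▸ hi)
      omega
  · rintro (⟨hlt, hS⟩ | ⟨T, hT, rfl⟩)
    · exact ⟨fun i hi => (hlt i hi).trans (by omega), hS⟩
    · rw [mem_legalSets] at hT
      refine ⟨fun i hi => ?_, (isLegalSet_insert_iff hn fun i hi => ?_).2 ⟨hT.2, hT.1⟩⟩
      · rw [Finset.mem_insert] at hi
        rcases hi with rfl | hi
        · omega
        · have := hT.1 i hi; omega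
      · have := hT.1 i hi; omega

theorem sum_legalSets_succ {n m : ℕ} (hn : 1 ≤ n) (x : ℕ) {M : Type*} [AddCommMonoid M]
    (f : Finset ℕ → M) :
    ∑ S ∈ legalSets n m (x + 1), f S = ∑ S ∈ legalSets n m x, f S +
      ∑ S ∈ legalSets n m (binStart n m (binNumber n m x - 1)), f (insert x S) := by
  have hle := binStart_binNumber_sub_one_le (m := m) hn x
  have hnot : ∀ S ∈ legalSets n m (binStart n m (binNumber n m x - 1)), x ∉ S := by
    intro S hS hx
    have := (mem_legalSets.1 hS).1 x hx
    omega
  rw [legalSets_succ hn, Finset.sum_union, Finset.sum_image]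
  · intro S hS T hT hST
    have := congrArg (fun U => U.erase x) hST
    simpa [Finset.erase_insert (hnot S hS), Finset.erase_insert (hnot T hT)] using this
  · rw [Finset.disjoint_left]
    intro S hS hS'
    obtain ⟨T, -, rfl⟩ := Finset.mem_image.1 hS'
    exact lt_irrefl x ((mem_legalSets.1 hS).1 x (Finset.mem_insert_self _ _))

/-! ### Legal sets below `x` correspond to the integers below `a x` -/

namespace IsBinSequence

variable {n m : ℕ} {a : ℕ → ℕ}

theorem sum_injOn (ha : IsBinSequence n m a) {S T : Finset ℕ} (hS : IsLegalSet n m S)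
    (hT : IsLegalSet n m T) (h : ∑ i ∈ S, a i = ∑ i ∈ T, a i) : S = T := by
  -- Uniqueness is assumed only for positive integers; for 0 it comes from positivity of the terms.
  rcases Nat.eq_zero_or_pos (∑ i ∈ S, a i) with h0 | hpos
  · have key : ∀ U : Finset ℕ, ∑ i ∈ U, a i = 0 → U = ∅ := fun U hU =>
      Finset.eq_empty_of_forall_notMem fun i hi =>
        (ha.pos i).ne' (Finset.sum_eq_zero_iff.1 hU i hi)
    rw [key S h0, key T (h ▸ h0)]
  · exact (ha.existsUnique_legal _ hpos).unique (isLegalDecomposition_iff.2 ⟨hS, rfl⟩)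
      (isLegalDecomposition_iff.2 ⟨hT, h.symm⟩)

theorem exists_legalSet (ha : IsBinSequence n m a) (z : ℕ) :
    ∃ S, IsLegalSet n m S ∧ ∑ i ∈ S, a i = z := by
  rcases Nat.eq_zero_or_pos z with rfl | hz
  · exact ⟨∅, isLegalSet_empty n m, by simp⟩
  · obtain ⟨S, hS, -⟩ := ha.existsUnique_legal z hz
    exact ⟨S, isLegalDecomposition_iff.1 hS⟩

theorem lt_of_sum_lt (ha : IsBinSequence n m a) {S : Finset ℕ} {x : ℕ}
    (h : ∑ i ∈ S, a i < a x) {i : ℕ} (hi : i ∈ S) : i < x :=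
  ha.strictMono.lt_iff_lt.1
    ((Finset.single_le_sum (f := a) (fun _ _ => Nat.zero_le _) hi).trans_lt h)

theorem isLegalSet_singleton (n m x : ℕ) : IsLegalSet n m {x} := by
  constructor
  · intro i hi j hj hij
    rw [Finset.mem_singleton] at hi hj
    exact absurd (hi.trans hj.symm) hij
  · intro i hi j hj
    rw [Finset.mem_singleton] at hi hj
    subst hi hj
    omega

/-- Surjectivity is immediate, as a sum below `a x` uses only indices below `x`. The bound on the
sums is by strong induction, separating the sets that contain the top index, and rests on `a x + a y
≤ a (x + 1)`. -/
theorem image_sum_legalSets (ha : IsBinSequence n m a) (hn : 1 ≤ n) (x : ℕ) :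
    (legalSets n m x).image (fun S => ∑ i ∈ S, a i) = Finset.range (a x) := by
  suffices h : ∀ S ∈ legalSets n m x, ∑ i ∈ S, a i < a x by
    ext z
    simp only [Finset.mem_image, Finset.mem_range]
    constructor
    · rintro ⟨S, hS, rfl⟩
      exact h S hS
    · intro hz
      obtain ⟨S, hS, rfl⟩ := ha.exists_legalSet z
      exact ⟨S, mem_legalSets.2 ⟨fun i hi => ha.lt_of_sum_lt hz hi, hS⟩, rfl⟩
  induction x using Nat.strong_induction_on with
  | _ x ih =>
    rcases x with _ | x
    · simp [legalSets_zero, ha.pos]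
    · set y := binStart n m (binNumber n m x - 1) with hy
      have hyx : y ≤ x := binStart_binNumber_sub_one_le hn x
      have hle : a x + a y ≤ a (x + 1) := by
        -- Otherwise `a (x + 1) - a x < a y` decomposes with indices below `y`; adding `x` gives a
        -- legal decomposition of `a (x + 1)` other than `{x + 1}`.
        by_contra! hlt
        have hmono : a x < a (x + 1) := ha.strictMono (Nat.lt_succ_self x)
        obtain ⟨S, hS, hsum⟩ := ha.exists_legalSet (a (x + 1) - a x)
        have hSy : ∀ i ∈ S, i < y := fun i hi => ha.lt_of_sum_lt (by omega) hi
        have hSx : ∀ i ∈ S, i < x := fun i hi => (hSy i hi).trans_le hyx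
        have hleg := (isLegalSet_insert_iff hn hSx).2 ⟨hS, hSy⟩
        have hxS : x ∉ S := fun h => lt_irrefl x (hSx x h)
        have heq := ha.sum_injOn hleg (isLegalSet_singleton n m (x + 1)) (by
          rw [Finset.sum_insert hxS, hsum, Finset.sum_singleton]
          omega)
        have : x ∈ ({x + 1} : Finset ℕ) := heq ▸ Finset.mem_insert_self x S
        simp at this
      intro S hS
      rw [legalSets_succ hn, Finset.mem_union, Finset.mem_image] at hS
      rcases hS with hS | ⟨T, hT, rfl⟩
      · exact (ih x (Nat.lt_succ_self x) S hS).trans (ha.strictMono (Nat.lt_succ_self x))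
      · have hT' := ih y (by omega) T hT
        have hxT : x ∉ T := fun h => by
          have := (mem_legalSets.1 hT).1 x h
          omega
        rw [Finset.sum_insert hxT]
        omega

theorem numSummands_sum (ha : IsBinSequence n m a) {S : Finset ℕ} (hS : IsLegalSet n m S) :
    numSummands n m a (∑ i ∈ S, a i) = S.card := by
  have h : ∃ T, IsLegalDecomposition n m a (∑ i ∈ S, a i) T :=
    ⟨S, isLegalDecomposition_iff.2 ⟨hS, rfl⟩⟩
  rw [numSummands, dif_pos h]
  have h' := isLegalDecomposition_iff.1 h.choose_spec
  rw [ha.sum_injOn h'.1 hS h'.2]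

theorem sum_range_numSummands (ha : IsBinSequence n m a) (hn : 1 ≤ n) (x : ℕ) {M : Type*}
    [AddCommMonoid M] (f : ℕ → M) :
    ∑ z ∈ Finset.range (a x), f (numSummands n m a z) =
      ∑ S ∈ legalSets n m x, f S.card := by
  rw [← ha.image_sum_legalSets hn x, Finset.sum_image]
  · exact Finset.sum_congr rfl fun S hS => by rw [ha.numSummands_sum (mem_legalSets.1 hS).2]
  · exact fun S hS T hT h => ha.sum_injOn (mem_legalSets.1 hS).2 (mem_legalSets.1 hT).2 h

theorem card_legalSets (ha : IsBinSequence n m a) (hn : 1 ≤ n) (x : ℕ) :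
    (legalSets n m x).card = a x := by
  rw [Finset.card_eq_sum_ones, ← ha.sum_range_numSummands hn x (fun _ => 1)]
  simp

end IsBinSequence

/-! ### Generating function and its recursion -/

section GeneratingFunction

variable {K : Type*} [CommRing K]

/-- The generating function of the number of elements of the legal sets of indices in the first
`2 q` bins. -/
noncomputable def legalGenFun (n m q : ℕ) (t : K) : K :=
  ∑ S ∈ legalSets n m ((n + m) * q), t ^ S.card

theorem sum_pow_card_legalSets_succ {n m : ℕ} (hn : 1 ≤ n) (x : ℕ) (t : K) :
    ∑ S ∈ legalSets n m (x + 1), t ^ S.card = ∑ S ∈ legalSets n m x, t ^ S.card +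
      t * ∑ S ∈ legalSets n m (binStart n m (binNumber n m x - 1)), t ^ S.card := by
  rw [sum_legalSets_succ hn, Finset.mul_sum]
  congr 1
  refine Finset.sum_congr rfl fun S hS => ?_
  have hx : x ∉ S := fun h => by
    have h1 := (mem_legalSets.1 hS).1 x h
    have h2 := binStart_binNumber_sub_one_le (m := m) hn x
    omega
  rw [Finset.card_insert_of_notMem hx, pow_succ']

theorem binNumber_eq_of_mem_Ico {n m : ℕ} (hn : 1 ≤ n) {x b : ℕ} (h1 : binStart n m b ≤ x)
    (h2 : x < binStart n m (b + 1)) : binNumber n m x = b := by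
  rw [lt_binStart_iff hn] at h2
  rw [← not_lt, lt_binStart_iff hn] at h1
  omega

/-- All indices of one bin have the same admissible companions, so each contributes the same amount.
For `b = 0` the truncated `b - 1` leaves only the empty companion set. -/
theorem sum_pow_card_legalSets_binStart_add {n m : ℕ} (hn : 1 ≤ n) (b : ℕ) (t : K) (i : ℕ)
    (hi : binStart n m b + i ≤ binStart n m (b + 1)) :
    ∑ S ∈ legalSets n m (binStart n m b + i), t ^ S.card =
      ∑ S ∈ legalSets n m (binStart n m b), t ^ S.card +
        i * t * ∑ S ∈ legalSets n m (binStart n m (b - 1)), t ^ S.card := by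
  induction i with
  | zero => simp
  | succ i ih =>
    rw [← Nat.add_assoc, sum_pow_card_legalSets_succ hn, ih (by omega),
      binNumber_eq_of_mem_Ico hn (Nat.le_add_right _ _) (by omega)]
    push_cast
    ring

theorem sum_pow_card_legalSets_odd {n m : ℕ} (hn : 1 ≤ n) (q : ℕ) (t : K) :
    ∑ S ∈ legalSets n m (binStart n m (2 * q + 1)), t ^ S.card = legalGenFun n m q t +
      n * t * ∑ S ∈ legalSets n m (binStart n m (2 * q - 1)), t ^ S.card := by
  have h := sum_pow_card_legalSets_binStart_add (n := n) (m := m) hn (2 * q) t n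
    (by rw [binStart_two_mul, binStart_two_mul_add_one])
  rw [binStart_two_mul] at h
  rw [binStart_two_mul_add_one, h, legalGenFun]

theorem legalGenFun_succ {n m : ℕ} (hn : 1 ≤ n) (q : ℕ) (t : K) :
    legalGenFun n m (q + 1) t =
      ∑ S ∈ legalSets n m (binStart n m (2 * q + 1)), t ^ S.card +
        m * t * legalGenFun n m q t := by
  have h : binStart n m (2 * q + 1) + m = binStart n m (2 * q + 1 + 1) := by
    rw [show 2 * q + 1 + 1 = 2 * (q + 1) by ring, binStart_two_mul, binStart_two_mul_add_one]
    ring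
  have h' := sum_pow_card_legalSets_binStart_add (n := n) (m := m) hn (2 * q + 1) t m h.le
  rw [h, show 2 * q + 1 + 1 = 2 * (q + 1) by ring, binStart_two_mul, Nat.add_sub_cancel,
    binStart_two_mul] at h'
  exact h'

theorem legalGenFun_zero (n m : ℕ) (t : K) : legalGenFun n m 0 t = 1 := by
  simp [legalGenFun, legalSets_zero]

theorem legalGenFun_one {n m : ℕ} (hn : 1 ≤ n) (t : K) :
    legalGenFun n m 1 t = 1 + (n + m) * t := by
  have h := legalGenFun_succ (m := m) hn 0 t
  rw [sum_pow_card_legalSets_odd hn] at h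
  simp only [legalGenFun_zero, zero_add, mul_zero, Nat.zero_sub, binStart, Nat.zero_div,
    Nat.zero_mod, if_true, legalSets_zero, Finset.sum_singleton, Finset.card_empty, pow_zero] at h
  rw [h]
  ring

theorem legalGenFun_add_two {n m : ℕ} (hn : 1 ≤ n) (q : ℕ) (t : K) :
    legalGenFun n m (q + 2) t =
      (1 + (n + m) * t) * legalGenFun n m (q + 1) t - n * m * t ^ 2 * legalGenFun n m q t := by
  have h1 := legalGenFun_succ (m := m) hn (q + 1) t
  have h2 := legalGenFun_succ (m := m) hn q t
  have h3 := sum_pow_card_legalSets_odd (m := m) hn (q + 1) t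
  rw [show 2 * (q + 1) - 1 = 2 * q + 1 by omega] at h3
  rw [h1, h3]
  -- `h2` expresses the sum ending at an odd bin as W_{q+1} - m t W_q, which eliminates it.
  linear_combination (-(n * t)) * h2

end GeneratingFunction

theorem ofReal_legalGenFun (n m q : ℕ) (t : ℝ) :
    ((legalGenFun n m q t : ℝ) : ℂ) = legalGenFun n m q (t : ℂ) := by
  simp [legalGenFun]

/-! ### Factorization through Chebyshev polynomials -/

section Factorization

open Polynomial Chebyshev

theorem U_eval_complex_eq_prod (q : ℕ) (x : ℂ) :
    (U ℂ q).eval x =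
      ∏ j ∈ Finset.range q, (2 * (x - (Real.cos ((j + 1) * Real.pi / (q + 1)) : ℝ))) := by
  have hcard : (U ℝ q).roots.card = (U ℝ q).natDegree := by
    rw [natDegree_U_natCast, roots_U_real, Finset.card_val, Finset.card_image_of_injOn,
      Finset.card_range]
    exact (Finset.range q).nodup_map_iff_injOn.mp (roots_U_real_nodup q)
  have h := C_leadingCoeff_mul_prod_multiset_X_sub_C hcard
  rw [leadingCoeff_U_natCast, roots_U_real] at h
  have h2 : (((Finset.range q).image
      (fun k : ℕ => Real.cos ((k + 1) * Real.pi / (q + 1)))).val.map fun a => X - C a).prod =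
      ∏ j ∈ Finset.range q, (X - C (Real.cos ((j + 1) * Real.pi / (q + 1)))) := by
    change ∏ a ∈ (Finset.range q).image
      (fun k : ℕ => Real.cos ((k + 1) * Real.pi / (q + 1))), (X - C a) = _
    rw [Finset.prod_image]
    exact (Finset.range q).nodup_map_iff_injOn.mp (roots_U_real_nodup q)
  rw [h2] at h
  rw [← aeval_U (R := ℝ), ← h, Finset.prod_mul_distrib]
  simp [map_prod]

/-- Dividing by (√(nm) t)^q turns the recursion into U_{q+2} = 2X U_{q+1} - U_q. Complex `t` is
needed for characteristic functions, where t = e^{iθ}. -/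
theorem legalGenFun_eq_U {n m : ℕ} (hn : 1 ≤ n) (hm : 1 ≤ m) (q : ℕ) {t : ℂ} (ht : t ≠ 0) :
    legalGenFun n m q t = ((√(n * m : ℝ) : ℝ) * t) ^ q *
      (U ℂ q).eval ((1 + (n + m) * t) / (2 * ((√(n * m : ℝ) : ℝ) * t))) := by
  have hr : (0 : ℝ) < √(n * m : ℝ) := Real.sqrt_pos.2 (by positivity)
  have hr2 : ((√(n * m : ℝ) : ℝ) : ℂ) ^ 2 = n * m := by
    rw [← Complex.ofReal_pow, Real.sq_sqrt (by positivity)]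
    push_cast
    rfl
  set r : ℂ := ((√(n * m : ℝ) : ℝ) : ℂ)
  have hr0 : r ≠ 0 := Complex.ofReal_ne_zero.2 hr.ne'
  induction q using Nat.twoStepInduction with
  | zero => simp [legalGenFun_zero]
  | one =>
    rw [legalGenFun_one hn]
    simp only [Nat.cast_one, U_one, eval_mul, eval_X, eval_ofNat]
    field_simp
  | more q ih1 ih2 =>
    rw [legalGenFun_add_two hn, ih1, ih2]
    push_cast
    rw [U_add_two, ← hr2]
    simp only [eval_sub, eval_mul, eval_X, eval_ofNat]
    field_simp
    ring

/-- The negative reciprocals of the zeros of the generating function. -/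
noncomputable def genFunCoeff (n m q j : ℕ) : ℝ :=
  n + m - 2 * √(n * m : ℝ) * Real.cos ((j + 1) * Real.pi / (q + 1))

theorem genFunCoeff_nonneg (n m q j : ℕ) : 0 ≤ genFunCoeff n m q j := by
  unfold genFunCoeff
  have h1 := Real.cos_le_one ((j + 1) * Real.pi / (q + 1))
  have h2 : √(n * m : ℝ) = √n * √m := Real.sqrt_mul (by positivity) _
  have hn : √(n : ℝ) ^ 2 = n := Real.sq_sqrt (by positivity)
  have hm : √(m : ℝ) ^ 2 = m := Real.sq_sqrt (by positivity)
  have h3 := mul_le_mul_of_nonneg_left h1 (Real.sqrt_nonneg (n * m : ℝ))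
  -- AM-GM: n + m ≥ 2√(nm).
  nlinarith [sq_nonneg (√(n : ℝ) - √m)]

theorem legalGenFun_eq_prod {n m : ℕ} (hn : 1 ≤ n) (hm : 1 ≤ m) (q : ℕ) {t : ℂ} (ht : t ≠ 0) :
    legalGenFun n m q t = ∏ j ∈ Finset.range q, (1 + genFunCoeff n m q j * t) := by
  have hr : (0 : ℝ) < √(n * m : ℝ) := Real.sqrt_pos.2 (by positivity)
  rw [legalGenFun_eq_U hn hm q ht, U_eval_complex_eq_prod]
  conv_lhs => rw [← Finset.card_range q, ← Finset.prod_const, Finset.card_range]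
  rw [← Finset.prod_mul_distrib]
  refine Finset.prod_congr rfl fun j _ => ?_
  unfold genFunCoeff
  push_cast
  have hr0 : ((√(n * m : ℝ) : ℝ) : ℂ) ≠ 0 := Complex.ofReal_ne_zero.2 hr.ne'
  field_simp
  ring

theorem legalGenFun_real_eq_prod {n m : ℕ} (hn : 1 ≤ n) (hm : 1 ≤ m) (q : ℕ) {t : ℝ}
    (ht : t ≠ 0) :
    legalGenFun n m q t = ∏ j ∈ Finset.range q, (1 + genFunCoeff n m q j * t) := by
  apply Complex.ofReal_injective
  rw [ofReal_legalGenFun, legalGenFun_eq_prod hn hm q (Complex.ofReal_ne_zero.2 ht)]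
  push_cast
  rfl

end Factorization

/-! ### Moments as logarithmic derivatives of the generating function -/

theorem integral_uniformOn_Iio {E : Type*} [NormedAddCommGroup E] [NormedSpace ℝ E]
    [CompleteSpace E] (N : ℕ) (f : ℕ → E) :
    ∫ z, f z ∂(uniformOn (Set.Iio N)) = (N : ℝ)⁻¹ • ∑ z ∈ Finset.range N, f z := by
  have hN : (Set.Iio N) = ((Finset.range N : Finset ℕ) : Set ℕ) := by
    ext; simp
  rw [uniformOn, ProbabilityTheory.cond, integral_smul_measure, hN, setIntegral_finset]
  · rw [Measure.count_apply_finset]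
    simp [Measure.real]
  · rw [← (Finset.range N : Set ℕ).biUnion_of_singleton]
    simp only [Finset.mem_coe]
    exact integrableOn_finset_iUnion.2 fun x _ => integrableOn_singleton (hx := by simp)

namespace IsBinSequence

variable {n m : ℕ} {a : ℕ → ℕ}

theorem integral_numSummands (ha : IsBinSequence n m a) (hn : 1 ≤ n) {E : Type*}
    [NormedAddCommGroup E] [NormedSpace ℝ E] [CompleteSpace E] (k : ℕ) (f : ℕ → E) :
    ∫ z, f (numSummands n m a z) ∂(uniformLaw n m a k) =
      (legalGenFun n m k (1 : ℝ))⁻¹ • ∑ S ∈ legalSets n m ((n + m) * k), f S.card := by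
  rw [uniformLaw, integral_uniformOn_Iio, ha.sum_range_numSummands hn,
    ← ha.card_legalSets hn, legalGenFun]
  simp

theorem summandMean_eq (ha : IsBinSequence n m a) (hn : 1 ≤ n) (k : ℕ) :
    summandMean n m a k = (legalGenFun n m k (1 : ℝ))⁻¹ *
      ∑ S ∈ legalSets n m ((n + m) * k), (S.card : ℝ) :=
  ha.integral_numSummands hn k (fun j => (j : ℝ))

theorem summandVariance_eq (ha : IsBinSequence n m a) (hn : 1 ≤ n) (k : ℕ) :
    summandVariance n m a k = (legalGenFun n m k (1 : ℝ))⁻¹ *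
      ∑ S ∈ legalSets n m ((n + m) * k), ((S.card : ℝ) - summandMean n m a k) ^ 2 := by
  rw [summandVariance, variance_eq_integral (measurable_of_countable _).aemeasurable]
  exact ha.integral_numSummands hn k (fun j => ((j : ℝ) - summandMean n m a k) ^ 2)

end IsBinSequence

theorem legalGenFun_pos {n m k : ℕ} {t : ℝ} (ht : 0 < t) : 0 < legalGenFun n m k t := by
  refine Finset.sum_pos (fun S _ => by positivity) ⟨∅, ?_⟩
  exact mem_legalSets.2 ⟨by simp, isLegalSet_empty n m⟩

/-- The mean of the number of elements of a legal set drawn with probability proportional to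
`t ^ S.card`. -/
noncomputable def tiltedMean (n m k : ℕ) (t : ℝ) : ℝ :=
  (∑ S ∈ legalSets n m ((n + m) * k), (S.card : ℝ) * t ^ S.card) / legalGenFun n m k t

/-- This form avoids the truncated exponent `j - 1`. -/
theorem hasDerivAt_pow_of_pos (j : ℕ) {t : ℝ} (ht : 0 < t) :
    HasDerivAt (fun t : ℝ => t ^ j) (j * t ^ j / t) t := by
  refine (hasDerivAt_pow j t).congr_deriv ?_
  rcases j with _ | j
  · simp
  · field_simp
    simp [pow_succ]

theorem hasDerivAt_legalGenFun (n m k : ℕ) {t : ℝ} (ht : 0 < t) :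
    HasDerivAt (fun t : ℝ => legalGenFun n m k t)
      (tiltedMean n m k t * legalGenFun n m k t / t) t := by
  have h : HasDerivAt (fun t : ℝ => ∑ S ∈ legalSets n m ((n + m) * k), t ^ S.card)
      (∑ S ∈ legalSets n m ((n + m) * k), S.card * t ^ S.card / t) t :=
    HasDerivAt.fun_sum fun S _ => hasDerivAt_pow_of_pos _ ht
  refine h.congr_deriv ?_
  rw [tiltedMean, div_mul_cancel₀ _ (legalGenFun_pos ht).ne', Finset.sum_div]

/-- At t = 1 the quotient rule gives E[N²] - E[N]², the variance of the cardinality N under the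
uniform law. -/
theorem hasDerivAt_tiltedMean (n m k : ℕ) :
    HasDerivAt (tiltedMean n m k) ((legalGenFun n m k (1 : ℝ))⁻¹ *
      ∑ S ∈ legalSets n m ((n + m) * k), ((S.card : ℝ) - tiltedMean n m k 1) ^ 2) 1 := by
  have hW : legalGenFun n m k (1 : ℝ) ≠ 0 := (legalGenFun_pos one_pos).ne'
  have h : HasDerivAt (fun t : ℝ => ∑ S ∈ legalSets n m ((n + m) * k), (S.card : ℝ) * t ^ S.card)
      (∑ S ∈ legalSets n m ((n + m) * k), (S.card : ℝ) * (S.card * 1 ^ S.card / 1)) 1 :=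
    HasDerivAt.fun_sum fun S _ => (hasDerivAt_pow_of_pos _ one_pos).const_mul _
  refine (h.fun_div (hasDerivAt_legalGenFun n m k one_pos) hW).congr_deriv ?_
  have h1 : ∑ S ∈ legalSets n m ((n + m) * k), (S.card : ℝ) =
      tiltedMean n m k 1 * legalGenFun n m k (1 : ℝ) := by
    rw [tiltedMean, div_mul_cancel₀ _ hW]
    simp
  have h2 : ((legalSets n m ((n + m) * k)).card : ℝ) = legalGenFun n m k (1 : ℝ) := by
    simp [legalGenFun]
  simp only [sub_sq, Finset.sum_add_distrib, Finset.sum_sub_distrib, one_pow, mul_one, div_one,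
    ← Finset.sum_mul, ← Finset.mul_sum, Finset.sum_const, nsmul_eq_mul, h1, h2, ← sq]
  field_simp
  ring

namespace IsBinSequence

variable {n m : ℕ} {a : ℕ → ℕ}

theorem summandMean_eq_tiltedMean (ha : IsBinSequence n m a) (hn : 1 ≤ n) (k : ℕ) :
    summandMean n m a k = tiltedMean n m k 1 := by
  rw [ha.summandMean_eq hn, tiltedMean, inv_mul_eq_div]
  simp

theorem hasDerivAt_tiltedMean_summandVariance (ha : IsBinSequence n m a) (hn : 1 ≤ n) (k : ℕ) :
    HasDerivAt (tiltedMean n m k) (summandVariance n m a k) 1 := by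
  rw [ha.summandVariance_eq hn, ha.summandMean_eq_tiltedMean hn]
  exact hasDerivAt_tiltedMean n m k

end IsBinSequence

/-! ### Bernoulli decomposition of the mean and the variance -/

/-- The parameters of the independent Bernoulli variables with the law of the number of summands
as the law of their sum. -/
noncomputable def bernoulliParam (n m k j : ℕ) : ℝ :=
  genFunCoeff n m k j / (1 + genFunCoeff n m k j)

theorem bernoulliParam_mem (n m k j : ℕ) : bernoulliParam n m k j ∈ Set.Icc (0 : ℝ) 1 := by
  have h := genFunCoeff_nonneg n m k j
  exact ⟨by unfold bernoulliParam; positivity, by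
    rw [bernoulliParam, div_le_one (by positivity)]; linarith⟩

theorem tiltedMean_eq_sum {n m : ℕ} (hn : 1 ≤ n) (hm : 1 ≤ m) (k : ℕ) {t : ℝ} (ht : 0 < t) :
    tiltedMean n m k t =
      ∑ j ∈ Finset.range k, genFunCoeff n m k j * t / (1 + genFunCoeff n m k j * t) := by
  have hne : ∀ j ∈ Finset.range k, 1 + genFunCoeff n m k j * t ≠ 0 := fun j _ => by
    have := genFunCoeff_nonneg n m k j
    positivity
  have h1 := (hasDerivAt_legalGenFun n m k ht).deriv
  have hev : (fun t : ℝ => legalGenFun n m k t) =ᶠ[nhds t]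
      fun t => ∏ j ∈ Finset.range k, (1 + genFunCoeff n m k j * t) := by
    filter_upwards [lt_mem_nhds ht] with s hs
    exact legalGenFun_real_eq_prod hn hm k hs.ne'
  have hd : ∀ j, HasDerivAt (fun t : ℝ => 1 + genFunCoeff n m k j * t) (genFunCoeff n m k j) t :=
    fun j => by simpa using ((hasDerivAt_id t).const_mul (genFunCoeff n m k j)).const_add 1
  have h2 := logDeriv_prod (s := Finset.range k) (f := fun j (t : ℝ) => 1 + genFunCoeff n m k j * t)
    (x := t) hne (fun j _ => (hd j).differentiableAt)
  rw [logDeriv_apply, ← hev.deriv_eq, h1, ← legalGenFun_real_eq_prod hn hm k ht.ne'] at h2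
  simp only [logDeriv_apply, (hd _).deriv] at h2
  have hW := (legalGenFun_pos (n := n) (m := m) (k := k) ht).ne'
  rw [div_div, mul_comm t, mul_comm (tiltedMean n m k t), mul_div_mul_left _ _ hW, div_eq_iff ht.ne'] at h2
  rw [h2, Finset.sum_mul]
  exact Finset.sum_congr rfl fun j _ => by rw [div_mul_eq_mul_div]

theorem tiltedMean_one_eq_sum {n m : ℕ} (hn : 1 ≤ n) (hm : 1 ≤ m) (k : ℕ) :
    tiltedMean n m k 1 = ∑ j ∈ Finset.range k, bernoulliParam n m k j := by
  simp [tiltedMean_eq_sum hn hm k one_pos, bernoulliParam]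

theorem IsBinSequence.summandVariance_eq_sum {n m : ℕ} {a : ℕ → ℕ} (ha : IsBinSequence n m a)
    (hn : 1 ≤ n) (hm : 1 ≤ m) (k : ℕ) :
    summandVariance n m a k =
      ∑ j ∈ Finset.range k, bernoulliParam n m k j * (1 - bernoulliParam n m k j) := by
  have h1 := ha.hasDerivAt_tiltedMean_summandVariance hn k
  have hev : tiltedMean n m k =ᶠ[nhds 1]
      fun t => ∑ j ∈ Finset.range k, genFunCoeff n m k j * t / (1 + genFunCoeff n m k j * t) := by
    filter_upwards [lt_mem_nhds one_pos] with s hs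
    exact tiltedMean_eq_sum hn hm k hs
  refine (h1.congr_of_eventuallyEq hev.symm).unique (HasDerivAt.fun_sum fun j _ => ?_)
  have hc := genFunCoeff_nonneg n m k j
  have hd : HasDerivAt (fun t : ℝ => genFunCoeff n m k j * t) (genFunCoeff n m k j) 1 := by
    simpa using (hasDerivAt_id (1 : ℝ)).const_mul (genFunCoeff n m k j)
  refine (hd.fun_div (hd.const_add 1) (by positivity)).congr_deriv ?_
  unfold bernoulliParam
  field_simp

/-! ### Characteristic functions and the Bernoulli central limit bound -/

theorem norm_prod_sub_prod_le_sum {ι : Type*} (s : Finset ι) (f g : ι → ℂ)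
    (hf : ∀ i ∈ s, ‖f i‖ ≤ 1) (hg : ∀ i ∈ s, ‖g i‖ ≤ 1) :
    ‖∏ i ∈ s, f i - ∏ i ∈ s, g i‖ ≤ ∑ i ∈ s, ‖f i - g i‖ := by
  classical
  induction s using Finset.induction_on with
  | empty => simp
  | insert i s hi ih =>
    rw [Finset.prod_insert hi, Finset.prod_insert hi, Finset.sum_insert hi]
    have h1 : ‖∏ j ∈ s, f j‖ ≤ 1 := by
      rw [norm_prod]
      exact Finset.prod_le_one (fun _ _ => norm_nonneg _)
        fun j hj => hf j (Finset.mem_insert_of_mem hj)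
    have h2 := hg i (Finset.mem_insert_self i s)
    have h3 := ih (fun j hj => hf j (Finset.mem_insert_of_mem hj))
      fun j hj => hg j (Finset.mem_insert_of_mem hj)
    calc ‖f i * ∏ j ∈ s, f j - g i * ∏ j ∈ s, g j‖
        = ‖(f i - g i) * ∏ j ∈ s, f j + g i * (∏ j ∈ s, f j - ∏ j ∈ s, g j)‖ := by
          congr 1; ring
      _ ≤ ‖f i - g i‖ * ‖∏ j ∈ s, f j‖ + ‖g i‖ * ‖∏ j ∈ s, f j - ∏ j ∈ s, g j‖ := by
          refine (norm_add_le _ _).trans ?_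
          rw [norm_mul, norm_mul]
      _ ≤ ‖f i - g i‖ * 1 + 1 * ∑ j ∈ s, ‖f j - g j‖ := by gcongr
      _ = _ := by ring

/-- The characteristic function of a centered Bernoulli variable. -/
noncomputable def bernoulliCharFun (p θ : ℝ) : ℂ :=
  (1 - p) * Complex.exp ((-(p * θ) : ℝ) * Complex.I) +
    p * Complex.exp (((1 - p) * θ : ℝ) * Complex.I)

theorem bernoulliCharFun_eq (p θ : ℝ) :
    bernoulliCharFun p θ =
      Complex.exp (-(p * θ) * Complex.I) * (1 - p + p * Complex.exp (θ * Complex.I)) := by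
  rw [bernoulliCharFun, mul_add, mul_left_comm, ← Complex.exp_add]
  push_cast
  ring_nf

theorem norm_bernoulliCharFun_le_one {p : ℝ} (hp : p ∈ Set.Icc (0 : ℝ) 1) (θ : ℝ) :
    ‖bernoulliCharFun p θ‖ ≤ 1 := by
  refine (norm_add_le _ _).trans ?_
  rw [norm_mul, norm_mul, Complex.norm_exp_ofReal_mul_I, Complex.norm_exp_ofReal_mul_I,
    ← Complex.ofReal_one, ← Complex.ofReal_sub, Complex.norm_of_nonneg (by linarith [hp.2]),
    Complex.norm_of_nonneg hp.1]
  linarith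

theorem norm_exp_mul_I_sub_le {x : ℝ} (hx : |x| ≤ 1) :
    ‖Complex.exp (x * Complex.I) - (1 + x * Complex.I - (x ^ 2 / 2 : ℝ))‖ ≤ |x| ^ 3 := by
  have hn : ‖(x : ℂ) * Complex.I‖ = |x| := by simp
  have h := Complex.exp_bound (x := x * Complex.I) (by rwa [hn]) (n := 3) (by norm_num)
  rw [hn] at h
  have hs : ∑ k ∈ Finset.range 3, ((x : ℂ) * Complex.I) ^ k / (k.factorial : ℂ) =
      1 + x * Complex.I - (x ^ 2 / 2 : ℝ) := by
    simp [Finset.sum_range_succ, mul_pow, Nat.factorial]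
    ring
  rw [hs] at h
  refine h.trans ?_
  have : (0 : ℝ) ≤ |x| ^ 3 := by positivity
  norm_num [Nat.factorial]
  linarith

/-- Centering cancels the linear Taylor terms, and the quadratic ones add up to v = p(1-p)θ²/2. The
two remainders, weighted by 1 - p and p, cost |θ|³ together; replacing 1 - v by e^{-v} costs at most
v² ≤ |θ|³. -/
theorem norm_bernoulliCharFun_sub_le {p θ : ℝ} (hp : p ∈ Set.Icc (0 : ℝ) 1) (hθ : |θ| ≤ 1) :
    ‖bernoulliCharFun p θ - Real.exp (-(p * (1 - p) * θ ^ 2 / 2))‖ ≤ 2 * |θ| ^ 3 := by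
  obtain ⟨hp0, hp1⟩ := hp
  have key : ∀ c : ℝ, |c| ≤ 1 → ‖Complex.exp ((c * θ : ℝ) * Complex.I) -
      (1 + (c * θ : ℝ) * Complex.I - ((c * θ) ^ 2 / 2 : ℝ))‖ ≤ |θ| ^ 3 := by
    intro c hc
    have hcθ : |c * θ| ≤ |θ| := by
      rw [abs_mul]
      exact mul_le_of_le_one_left (abs_nonneg _) hc
    exact (norm_exp_mul_I_sub_le (hcθ.trans hθ)).trans (pow_le_pow_left₀ (abs_nonneg _) hcθ 3)
  have h1 := key (-p) (by rw [abs_neg, abs_of_nonneg hp0]; exact hp1)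
  have h2 := key (1 - p) (by rw [abs_of_nonneg (by linarith)]; linarith)
  rw [neg_mul] at h1
  set v : ℝ := p * (1 - p) * θ ^ 2 / 2 with hv
  have hpp : p * (1 - p) ≤ 1 := by nlinarith
  have hpp0 : 0 ≤ p * (1 - p) := mul_nonneg hp0 (by linarith)
  have hθ3 : |θ| ^ 3 = |θ| * θ ^ 2 := by rw [pow_succ', sq_abs]
  have hθ2 : θ ^ 2 ≤ |θ| := by
    rw [← sq_abs]
    nlinarith [abs_nonneg θ]
  have hv0 : 0 ≤ v := by positivity
  have hvle : v ≤ θ ^ 2 / 2 := by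
    rw [hv]
    nlinarith [sq_nonneg θ]
  have hv1 : v ≤ 1 := by linarith
  have h3 : ‖((1 - v - Real.exp (-v) : ℝ) : ℂ)‖ ≤ |θ| ^ 3 := by
    rw [Complex.norm_real, Real.norm_eq_abs]
    have := Real.abs_exp_sub_one_sub_id_le (x := -v) (by rw [abs_neg, abs_of_nonneg hv0]; exact hv1)
    rw [abs_sub_comm]
    rw [show Real.exp (-v) - (1 - v) = Real.exp (-v) - 1 - -v by ring]
    refine this.trans ?_
    rw [hθ3]
    nlinarith [sq_nonneg θ, abs_nonneg θ]
  have hsplit : bernoulliCharFun p θ - Real.exp (-v) =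
      ((1 - p : ℝ) : ℂ) * (Complex.exp ((-(p * θ) : ℝ) * Complex.I) -
        (1 + (-(p * θ) : ℝ) * Complex.I - ((-(p * θ)) ^ 2 / 2 : ℝ))) +
      (p : ℂ) * (Complex.exp (((1 - p) * θ : ℝ) * Complex.I) -
        (1 + ((1 - p) * θ : ℝ) * Complex.I - (((1 - p) * θ) ^ 2 / 2 : ℝ))) +
      ((1 - v - Real.exp (-v) : ℝ) : ℂ) := by
    rw [bernoulliCharFun, hv]
    push_cast
    ring
  rw [hsplit]
  refine (norm_add_le _ _).trans ?_
  have h4 := norm_add_le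
    (((1 - p : ℝ) : ℂ) * (Complex.exp ((-(p * θ) : ℝ) * Complex.I) -
        (1 + (-(p * θ) : ℝ) * Complex.I - ((-(p * θ)) ^ 2 / 2 : ℝ))))
    ((p : ℂ) * (Complex.exp (((1 - p) * θ : ℝ) * Complex.I) -
        (1 + ((1 - p) * θ : ℝ) * Complex.I - (((1 - p) * θ) ^ 2 / 2 : ℝ))))
  rw [norm_mul, norm_mul, Complex.norm_of_nonneg (by linarith : (0 : ℝ) ≤ 1 - p),
    Complex.norm_of_nonneg hp0] at h4
  have h5 := mul_le_mul_of_nonneg_left h1 (by linarith : (0 : ℝ) ≤ 1 - p)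
  have h6 := mul_le_mul_of_nonneg_left h2 hp0
  linarith

/-- The central limit theorem for triangular arrays of independent Bernoulli variables, in terms of
characteristic functions. -/
theorem norm_prod_bernoulliCharFun_sub_le {k : ℕ} {p : ℕ → ℝ}
    (hp : ∀ j, p j ∈ Set.Icc (0 : ℝ) 1) {u σ2 : ℝ}
    (hσ : σ2 = ∑ j ∈ Finset.range k, p j * (1 - p j)) (hpos : 0 < σ2) (hu : |u / √σ2| ≤ 1) :
    ‖∏ j ∈ Finset.range k, bernoulliCharFun (p j) (u / √σ2) - Complex.exp (-(u ^ 2 / 2))‖ ≤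
      k * (2 * |u / √σ2| ^ 3) := by
  -- The Gaussian splits into one factor per Bernoulli variable because the individual variances add
  -- up to `σ2`.
  have hprod : Complex.exp (-(u ^ 2 / 2)) = ∏ j ∈ Finset.range k,
      ((Real.exp (-(p j * (1 - p j) * (u / √σ2) ^ 2 / 2)) : ℝ) : ℂ) := by
    rw [← Complex.ofReal_prod, ← Real.exp_sum, Finset.sum_neg_distrib, ← Finset.sum_div,
      ← Finset.sum_mul, ← hσ, div_pow, Real.sq_sqrt hpos.le, mul_div_cancel₀ _ hpos.ne']
    push_cast
    rfl
  rw [hprod]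
  refine (norm_prod_sub_prod_le_sum _ _ _ (fun j _ => norm_bernoulliCharFun_le_one (hp j) _)
    fun j _ => ?_).trans ?_
  · rw [Complex.norm_of_nonneg (Real.exp_pos _).le, Real.exp_le_one_iff, neg_nonpos]
    have := mul_nonneg (hp j).1 (sub_nonneg.2 (hp j).2)
    positivity
  · refine (Finset.sum_le_sum fun j _ => norm_bernoulliCharFun_sub_le (hp j) hu).trans ?_
    simp

/-- The left side is e^{-iμθ} W_k(e^{iθ}) / W_k(1). Each factor (1 + c e^{iθ}) / (1 + c) equals 1 -
p + p e^{iθ}, and e^{-iμθ} distributes since μ is the sum of the parameters. -/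
theorem IsBinSequence.charFun_normalizedSummandVar {n m : ℕ} {a : ℕ → ℕ}
    (ha : IsBinSequence n m a) (hn : 1 ≤ n) (hm : 1 ≤ m) (k : ℕ) (u : ℝ) :
    charFun ((uniformLaw n m a k).map (normalizedSummandVar n m a k)) u =
      ∏ j ∈ Finset.range k,
        bernoulliCharFun (bernoulliParam n m k j) (u / √(summandVariance n m a k)) := by
  rw [charFun_apply_real, integral_map (measurable_of_countable _).aemeasurable (by fun_prop)]
  set θ : ℝ := u / √(summandVariance n m a k) with hθ
  set μ := summandMean n m a k with hμ
  have hμ' : μ = ∑ j ∈ Finset.range k, bernoulliParam n m k j := by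
    rw [hμ, ha.summandMean_eq_tiltedMean hn, tiltedMean_one_eq_sum hn hm]
  have h := ha.integral_numSummands hn k
    (fun j => Complex.exp (-(μ * θ) * Complex.I) * Complex.exp (θ * Complex.I) ^ j)
  have hW := legalGenFun_pos (n := n) (m := m) (k := k) one_pos
  calc _ = ∫ z, Complex.exp (-(μ * θ) * Complex.I) *
      Complex.exp (θ * Complex.I) ^ (numSummands n m a z) ∂(uniformLaw n m a k) := by
        refine integral_congr_ae (Eventually.of_forall fun z => ?_)
        simp only [normalizedSummandVar, summandVar]
        rw [← Complex.exp_nat_mul, ← Complex.exp_add, ← hμ, hθ]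
        push_cast
        congr 1
        ring
    _ = (legalGenFun n m k (1 : ℝ))⁻¹ • (Complex.exp (-(μ * θ) * Complex.I) *
          legalGenFun n m k (Complex.exp (θ * Complex.I))) := by
        rw [h, ← Finset.mul_sum]
        rfl
    _ = _ := by
        rw [legalGenFun_eq_prod hn hm k (Complex.exp_ne_zero _),
          legalGenFun_real_eq_prod hn hm k one_ne_zero, hμ', Complex.real_smul]
        simp only [bernoulliCharFun_eq, Finset.prod_mul_distrib]
        rw [← Complex.exp_sum]
        push_cast
        rw [← Finset.sum_mul, Finset.sum_neg_distrib, ← Finset.sum_mul, mul_left_comm,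
          ← Finset.prod_inv_distrib, ← Finset.prod_mul_distrib]
        congr 1
        refine Finset.prod_congr rfl fun j _ => ?_
        have hc := genFunCoeff_nonneg n m k j
        have hc' : (1 : ℂ) + genFunCoeff n m k j ≠ 0 := by
          rw [← Complex.ofReal_one, ← Complex.ofReal_add]
          exact Complex.ofReal_ne_zero.2 (by positivity)
        rw [bernoulliParam]
        push_cast
        field_simp
        ring

/-! ### Binet formula and the characteristic roots -/

theorem sub_mul_legalGenFun {K : Type*} [CommRing K] {n m : ℕ} (hn : 1 ≤ n) (q : ℕ) {t x y : K}
    (hadd : x + y = 1 + (n + m) * t) (hmul : x * y = n * m * t ^ 2) :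
    (x - y) * legalGenFun n m q t = x ^ (q + 1) - y ^ (q + 1) := by
  induction q using Nat.twoStepInduction with
  | zero => simp [legalGenFun_zero]
  | one =>
    rw [legalGenFun_one hn, ← hadd]
    ring
  | more q ih1 ih2 =>
    rw [legalGenFun_add_two hn, ← hadd, ← hmul]
    linear_combination (x + y) * ih2 - x * y * ih1

/-- The square root of the discriminant of `X ^ 2 - (1 + (n + m) * t) * X + n * m * t ^ 2`. -/
noncomputable def sqrtDiscr (n m : ℕ) (t : ℝ) : ℝ :=
  √(1 + 2 * (n + m) * t + (n - m) ^ 2 * t ^ 2)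

/-- The larger root of `X ^ 2 - (1 + (n + m) * t) * X + n * m * t ^ 2`. -/
noncomputable def largeRoot (n m : ℕ) (t : ℝ) : ℝ :=
  (1 + (n + m) * t + sqrtDiscr n m t) / 2

/-- The smaller root of `X ^ 2 - (1 + (n + m) * t) * X + n * m * t ^ 2`. -/
noncomputable def smallRoot (n m : ℕ) (t : ℝ) : ℝ :=
  (1 + (n + m) * t - sqrtDiscr n m t) / 2

section Roots

variable {n m : ℕ} {t : ℝ}

theorem discr_pos (ht : 0 < t) : 0 < 1 + 2 * (n + m) * t + ((n : ℝ) - m) ^ 2 * t ^ 2 := by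
  positivity

theorem sqrtDiscr_pos (ht : 0 < t) : 0 < sqrtDiscr n m t :=
  Real.sqrt_pos.2 (discr_pos ht)

theorem sqrtDiscr_sq (ht : 0 < t) :
    sqrtDiscr n m t ^ 2 = 1 + 2 * (n + m) * t + ((n : ℝ) - m) ^ 2 * t ^ 2 :=
  Real.sq_sqrt (discr_pos ht).le

theorem largeRoot_add_smallRoot : largeRoot n m t + smallRoot n m t = 1 + (n + m) * t := by
  unfold largeRoot smallRoot
  ring

theorem largeRoot_sub_smallRoot : largeRoot n m t - smallRoot n m t = sqrtDiscr n m t := by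
  unfold largeRoot smallRoot
  ring

theorem largeRoot_mul_smallRoot (ht : 0 < t) :
    largeRoot n m t * smallRoot n m t = n * m * t ^ 2 := by
  unfold largeRoot smallRoot
  linear_combination (-1 / 4) * sqrtDiscr_sq (n := n) (m := m) ht

theorem largeRoot_pos (ht : 0 < t) : 0 < largeRoot n m t := by
  have := sqrtDiscr_pos (n := n) (m := m) ht
  unfold largeRoot
  positivity

theorem smallRoot_nonneg (ht : 0 < t) : 0 ≤ smallRoot n m t := by
  refine nonneg_of_mul_nonneg_right (?_ : 0 ≤ largeRoot n m t * _) (largeRoot_pos ht)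
  rw [largeRoot_mul_smallRoot ht]
  positivity

theorem hasDerivAt_sqrtDiscr (ht : 0 < t) :
    HasDerivAt (sqrtDiscr n m) ((n + m + ((n : ℝ) - m) ^ 2 * t) / sqrtDiscr n m t) t := by
  have h : HasDerivAt (fun t : ℝ => 1 + 2 * (n + m) * t + ((n : ℝ) - m) ^ 2 * t ^ 2)
      (2 * (n + m) * 1 + ((n : ℝ) - m) ^ 2 * (2 * t)) t := by
    refine HasDerivAt.add (((hasDerivAt_id t).const_mul _).const_add _) ?_
    simpa using (hasDerivAt_pow 2 t).const_mul (((n : ℝ) - m) ^ 2)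
  refine (h.sqrt (discr_pos ht).ne').congr_deriv ?_
  change _ / (2 * sqrtDiscr n m t) = _
  have := (sqrtDiscr_pos (n := n) (m := m) ht).ne'
  field_simp

theorem hasDerivAt_one_add_mul : HasDerivAt (fun t : ℝ => 1 + ((n : ℝ) + m) * t) (n + m) t := by
  simpa using ((hasDerivAt_id t).const_mul ((n : ℝ) + m)).const_add 1

theorem hasDerivAt_largeRoot (ht : 0 < t) :
    HasDerivAt (largeRoot n m) (largeRoot n m t * (1 - 1 / sqrtDiscr n m t) / t) t := by
  refine ((hasDerivAt_one_add_mul.add (hasDerivAt_sqrtDiscr ht)).div_const 2).congr_deriv ?_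
  have hR := (sqrtDiscr_pos (n := n) (m := m) ht).ne'
  unfold largeRoot
  field_simp
  linear_combination -sqrtDiscr_sq (n := n) (m := m) ht

theorem hasDerivAt_smallRoot (ht : 0 < t) :
    HasDerivAt (smallRoot n m) (smallRoot n m t * (1 + 1 / sqrtDiscr n m t) / t) t := by
  refine ((hasDerivAt_one_add_mul.sub (hasDerivAt_sqrtDiscr ht)).div_const 2).congr_deriv ?_
  have hR := (sqrtDiscr_pos (n := n) (m := m) ht).ne'
  unfold smallRoot
  field_simp
  linear_combination sqrtDiscr_sq (n := n) (m := m) ht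

/-- The quotient of the smaller by the larger root. -/
noncomputable def rootRatio (n m : ℕ) (t : ℝ) : ℝ :=
  smallRoot n m t / largeRoot n m t

theorem rootRatio_nonneg (ht : 0 < t) : 0 ≤ rootRatio n m t :=
  div_nonneg (smallRoot_nonneg ht) (largeRoot_pos ht).le

theorem rootRatio_lt_one (ht : 0 < t) : rootRatio n m t < 1 := by
  rw [rootRatio, div_lt_one (largeRoot_pos ht), ← sub_pos, largeRoot_sub_smallRoot]
  exact sqrtDiscr_pos ht

theorem hasDerivAt_rootRatio (ht : 0 < t) :
    HasDerivAt (rootRatio n m) (rootRatio n m t * (2 / (sqrtDiscr n m t * t))) t := by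
  have hP := (largeRoot_pos (n := n) (m := m) ht).ne'
  have hR := (sqrtDiscr_pos (n := n) (m := m) ht).ne'
  refine ((hasDerivAt_smallRoot ht).div (hasDerivAt_largeRoot ht) hP).congr_deriv ?_
  unfold rootRatio
  field_simp
  ring

theorem one_sub_rootRatio_pow_pos (ht : 0 < t) (k : ℕ) : 0 < 1 - rootRatio n m t ^ (k + 1) :=
  sub_pos.2 (pow_lt_one₀ (rootRatio_nonneg ht) (rootRatio_lt_one ht) (Nat.succ_ne_zero k))

/-- With R = x - y and ρ = y/x, W_k = x^(k+1) (1 - ρ^(k+1)) / R. The three terms are t times the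
logarithmic derivatives of these three factors; only the middle one involves ρ^(k+1). -/
theorem tiltedMean_eq_closed (hn : 1 ≤ n) (k : ℕ) (ht : 0 < t) :
    tiltedMean n m k t = (k + 1) * (1 - 1 / sqrtDiscr n m t)
      - 2 * (k + 1) * (rootRatio n m t ^ (k + 1) / (1 - rootRatio n m t ^ (k + 1))
        / sqrtDiscr n m t)
      - ((n + m) * t + ((n : ℝ) - m) ^ 2 * t ^ 2) / sqrtDiscr n m t ^ 2 := by
  have hP := (largeRoot_pos (n := n) (m := m) ht).ne'
  have hR := (sqrtDiscr_pos (n := n) (m := m) ht).ne'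
  have hρ := (one_sub_rootRatio_pow_pos (n := n) (m := m) ht k).ne'
  have hW := (legalGenFun_pos (n := n) (m := m) (k := k) ht).ne'
  have hpow : ∀ {f : ℝ → ℝ} {c : ℝ}, HasDerivAt f (f t * c / t) t →
      HasDerivAt (fun t => f t ^ (k + 1)) ((k + 1) * f t ^ (k + 1) * c / t) t := by
    intro f c hf
    refine (hf.fun_pow (k + 1)).congr_deriv ?_
    rw [Nat.add_sub_cancel, pow_succ]
    push_cast
    ring
  have h1 := (hpow (hasDerivAt_largeRoot (n := n) (m := m) ht)).fun_sub
    (hpow (hasDerivAt_smallRoot (n := n) (m := m) ht))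
  have h2 := (hasDerivAt_sqrtDiscr (n := n) (m := m) ht).fun_mul (hasDerivAt_legalGenFun n m k ht)
  have hev : (fun t => sqrtDiscr n m t * legalGenFun n m k t) =ᶠ[nhds t]
      fun t => largeRoot n m t ^ (k + 1) - smallRoot n m t ^ (k + 1) := by
    filter_upwards [lt_mem_nhds ht] with s hs
    rw [← largeRoot_sub_smallRoot]
    exact sub_mul_legalGenFun hn k largeRoot_add_smallRoot (largeRoot_mul_smallRoot hs)
  have heq := (h2.congr_of_eventuallyEq hev.symm).unique h1
  have hval := hev.self_of_nhds
  have hQ : smallRoot n m t ^ (k + 1) =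
      rootRatio n m t ^ (k + 1) * largeRoot n m t ^ (k + 1) := by
    rw [rootRatio, ← mul_pow, div_mul_cancel₀ _ hP]
  simp only [hQ] at heq hval
  have hx : largeRoot n m t ^ (k + 1) ≠ 0 := pow_ne_zero _ hP
  have hW' : legalGenFun n m k t =
      largeRoot n m t ^ (k + 1) * (1 - rootRatio n m t ^ (k + 1)) / sqrtDiscr n m t := by
    rw [eq_div_iff hR]
    linear_combination hval
  rw [hW'] at heq
  generalize tiltedMean n m k t = M at *
  generalize largeRoot n m t ^ (k + 1) = x at *
  generalize rootRatio n m t ^ (k + 1) = ρ at *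
  generalize sqrtDiscr n m t = R at *
  have ht' := ht.ne'
  field_simp at heq ⊢
  linear_combination heq

end Roots

/-! ### Asymptotics of the mean and the variance -/

theorem sqrtDiscr_one (n m : ℕ) : sqrtDiscr n m 1 = binBeta n m := by
  unfold sqrtDiscr binBeta
  congr 1
  ring

theorem binBeta_pos (n m : ℕ) : 0 < binBeta n m := by
  rw [← sqrtDiscr_one]
  exact sqrtDiscr_pos one_pos

theorem binBeta_sq (n m : ℕ) : binBeta n m ^ 2 = 1 + 2 * (n + m) + ((n : ℝ) - m) ^ 2 := by
  rw [← sqrtDiscr_one, sqrtDiscr_sq one_pos]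
  ring

theorem meanConst_pos {n m : ℕ} (hn : 1 ≤ n) : 0 < meanConst n m := by
  have hn' : (1 : ℝ) ≤ n := by exact_mod_cast hn
  have hm' : (0 : ℝ) ≤ m := Nat.cast_nonneg m
  refine div_pos ?_ (binBeta_pos n m)
  nlinarith [binBeta_sq n m, binBeta_pos n m, sq_nonneg ((n : ℝ) - m)]

theorem varianceConst_eq (n m : ℕ) :
    varianceConst n m = (n + m + ((n : ℝ) - m) ^ 2) / binBeta n m ^ 3 := by
  unfold varianceConst
  congr 1
  ring

theorem varianceConst_pos {n m : ℕ} (hn : 1 ≤ n) : 0 < varianceConst n m := by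
  have hn' : (1 : ℝ) ≤ n := by exact_mod_cast hn
  have := binBeta_pos n m
  rw [varianceConst_eq]
  positivity

theorem tendsto_pow_mul_rootRatio_pow (n m j : ℕ) :
    Tendsto (fun k : ℕ => ((k : ℝ) + 1) ^ j * rootRatio n m 1 ^ (k + 1)) atTop (nhds 0) := by
  have h := tendsto_pow_const_mul_const_pow_of_abs_lt_one j (r := rootRatio n m 1) (by
    rw [abs_of_nonneg (rootRatio_nonneg one_pos)]
    exact rootRatio_lt_one one_pos)
  simpa [Function.comp_def] using h.comp (tendsto_add_atTop_nat 1)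

theorem tendsto_one_sub_rootRatio_pow (n m : ℕ) :
    Tendsto (fun k : ℕ => 1 - rootRatio n m 1 ^ (k + 1)) atTop (nhds 1) := by
  simpa using (tendsto_pow_mul_rootRatio_pow n m 0).const_sub 1

theorem isBigO_tiltedMean_sub {n m : ℕ} (hn : 1 ≤ n) :
    (fun k : ℕ => tiltedMean n m k 1 - meanConst n m * (k : ℝ)) =O[atTop]
      (fun _ : ℕ => (1 : ℝ)) := by
  have hβ := (binBeta_pos n m).ne'
  have h : Tendsto (fun k : ℕ => meanConst n m - 2 * ((((k : ℝ) + 1) ^ 1 *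
      rootRatio n m 1 ^ (k + 1)) / (1 - rootRatio n m 1 ^ (k + 1)) / binBeta n m) -
      (n + m + ((n : ℝ) - m) ^ 2) / binBeta n m ^ 2) atTop (nhds _) :=
    ((((tendsto_pow_mul_rootRatio_pow n m 1).div (tendsto_one_sub_rootRatio_pow n m)
      one_ne_zero).div_const (binBeta n m)).const_mul 2).const_sub (meanConst n m) |>.sub_const _
  refine (h.isBigO_one ℝ).congr_left fun k => ?_
  rw [tiltedMean_eq_closed hn k one_pos, sqrtDiscr_one, meanConst]
  field_simp
  ring

/-- The leading constant is R'/R² at t = 1. The value of `c`, the derivative of the term free of k,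
is irrelevant; only its independence of `k` matters. -/
theorem hasDerivAt_tiltedMean_closed {n m : ℕ} (hn : 1 ≤ n) : ∃ c : ℝ, ∀ k : ℕ,
    HasDerivAt (tiltedMean n m k) ((k + 1) * varianceConst n m
      - 2 * (k + 1) * (2 * (k + 1) * rootRatio n m 1 ^ (k + 1)
          / (1 - rootRatio n m 1 ^ (k + 1)) ^ 2 / binBeta n m ^ 2
        - rootRatio n m 1 ^ (k + 1) / (1 - rootRatio n m 1 ^ (k + 1)) * varianceConst n m)
      - c) 1 := by
  have hβ := (binBeta_pos n m).ne'
  have hR := hasDerivAt_sqrtDiscr (n := n) (m := m) one_pos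
  have hR0 : sqrtDiscr n m 1 ≠ 0 := by rwa [sqrtDiscr_one]
  have he : DifferentiableAt ℝ
      (fun t : ℝ => ((n + m) * t + ((n : ℝ) - m) ^ 2 * t ^ 2) / sqrtDiscr n m t ^ 2) 1 := by
    have := hR.differentiableAt
    fun_prop (disch := exact pow_ne_zero 2 hR0)
  refine ⟨deriv (fun t : ℝ => ((n + m) * t + ((n : ℝ) - m) ^ 2 * t ^ 2) / sqrtDiscr n m t ^ 2) 1,
    fun k => ?_⟩
  have hev := (lt_mem_nhds (one_pos (α := ℝ))).mono
    fun t ht => tiltedMean_eq_closed (n := n) (m := m) hn k ht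
  have hρ := (hasDerivAt_rootRatio (n := n) (m := m) one_pos).fun_pow (k + 1)
  have hρ1 := (one_sub_rootRatio_pow_pos (n := n) (m := m) one_pos k).ne'
  have h1 : HasDerivAt (fun t : ℝ => ((k : ℝ) + 1) * (1 - 1 / sqrtDiscr n m t)) _ 1 :=
    (((hasDerivAt_const (1 : ℝ) (1 : ℝ)).fun_div hR hR0).const_sub 1).const_mul _
  have h2 := ((hρ.fun_div (hρ.const_sub 1) hρ1).fun_div hR hR0).const_mul (2 * ((k : ℝ) + 1))
  refine (((h1.fun_sub h2).fun_sub he.hasDerivAt).congr_of_eventuallyEq hev).congr_deriv ?_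
  congr 1
  rw [varianceConst_eq, sqrtDiscr_one]
  rw [Nat.add_sub_cancel]
  have hpow : rootRatio n m 1 ^ (k + 1) = rootRatio n m 1 ^ k * rootRatio n m 1 := pow_succ _ _
  rw [hpow] at hρ1 ⊢
  generalize rootRatio n m 1 ^ k = x at *
  push_cast
  field_simp
  ring

theorem IsBinSequence.isBigO_summandVariance_sub {n m : ℕ} {a : ℕ → ℕ}
    (ha : IsBinSequence n m a) (hn : 1 ≤ n) :
    (fun k : ℕ => summandVariance n m a k - varianceConst n m * (k : ℝ)) =O[atTop]
      (fun _ : ℕ => (1 : ℝ)) := by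
  obtain ⟨c, hc⟩ := hasDerivAt_tiltedMean_closed (n := n) (m := m) hn
  have h1 := tendsto_pow_mul_rootRatio_pow n m 1
  have h2 := tendsto_pow_mul_rootRatio_pow n m 2
  have h3 := tendsto_one_sub_rootRatio_pow n m
  have h : Tendsto (fun k : ℕ => varianceConst n m
      - 4 * ((((k : ℝ) + 1) ^ 2 * rootRatio n m 1 ^ (k + 1))
        / (1 - rootRatio n m 1 ^ (k + 1)) ^ 2 / binBeta n m ^ 2)
      + 2 * ((((k : ℝ) + 1) ^ 1 * rootRatio n m 1 ^ (k + 1))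
        / (1 - rootRatio n m 1 ^ (k + 1)) * varianceConst n m) - c) atTop (nhds _) :=
    (((((h2.div (h3.pow 2) (by norm_num)).div_const _).const_mul 4).const_sub _).add
      (((h1.div h3 one_ne_zero).mul_const _).const_mul 2)).sub_const c
  refine (h.isBigO_one ℝ).congr_left fun k => ?_
  rw [(ha.hasDerivAt_tiltedMean_summandVariance hn k).unique (hc k)]
  ring

theorem IsBinSequence.tendsto_summandVariance_div {n m : ℕ} {a : ℕ → ℕ}
    (ha : IsBinSequence n m a) (hn : 1 ≤ n) :
    Tendsto (fun k : ℕ => summandVariance n m a k / k) atTop (nhds (varianceConst n m)) := by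
  have h : Tendsto (fun k : ℕ => (summandVariance n m a k - varianceConst n m * (k : ℝ)) / k)
      atTop (nhds 0) := by
    have hlittle : (fun _ : ℕ => (1 : ℝ)) =o[atTop] (fun k : ℕ => (k : ℝ)) :=
      isLittleO_const_left.2 (Or.inr (tendsto_norm_atTop_atTop.comp tendsto_natCast_atTop_atTop))
    exact ((ha.isBigO_summandVariance_sub hn).trans_isLittleO hlittle).tendsto_div_nhds_zero
  have h' := h.add_const (varianceConst n m)
  rw [zero_add] at h'
  refine h'.congr' ?_
  filter_upwards [eventually_gt_atTop 0] with k hk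
  have : (k : ℝ) ≠ 0 := by positivity
  field_simp
  ring

/-! ### Convergence to the normal law -/

theorem IsBinSequence.tendsto_charFun {n m : ℕ} {a : ℕ → ℕ} (ha : IsBinSequence n m a)
    (hn : 1 ≤ n) (hm : 1 ≤ m) (u : ℝ) :
    Tendsto (fun k : ℕ => charFun ((uniformLaw n m a k).map (normalizedSummandVar n m a k)) u)
      atTop (nhds (Complex.exp (-(u ^ 2 / 2)))) := by
  have hC := varianceConst_pos (m := m) hn
  have hlim := ha.tendsto_summandVariance_div hn
  have htop : Tendsto (fun k : ℕ => summandVariance n m a k) atTop atTop := by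
    refine (hlim.pos_mul_atTop hC tendsto_natCast_atTop_atTop).congr' ?_
    filter_upwards [eventually_gt_atTop 0] with k hk
    exact div_mul_cancel₀ _ (by positivity)
  have hθ : Tendsto (fun k : ℕ => |u / √(summandVariance n m a k)|) atTop (nhds 0) := by
    have := ((Real.tendsto_sqrt_atTop.comp htop).const_div_atTop u).abs
    simpa using this
  have hbound : Tendsto (fun k : ℕ => (k : ℝ) * (2 * |u / √(summandVariance n m a k)| ^ 3))
      atTop (nhds 0) := by
    -- With θ = u/σ the bound 2k|θ|³ equals 2u² (k/σ²) |θ|, where k/σ² converges and θ tends to 0.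
    have h := ((hlim.inv₀ hC.ne').mul hθ).const_mul (2 * u ^ 2)
    rw [mul_zero, mul_zero] at h
    refine h.congr' ?_
    filter_upwards [htop.eventually_gt_atTop 0] with k hk
    rw [pow_succ |u / _|, sq_abs, div_pow, Real.sq_sqrt hk.le]
    field_simp
  rw [tendsto_iff_norm_sub_tendsto_zero]
  refine squeeze_zero' (Eventually.of_forall fun _ => norm_nonneg _) ?_ hbound
  filter_upwards [htop.eventually_gt_atTop 0, hθ.eventually_le_const one_pos] with k hk hk1
  rw [ha.charFun_normalizedSummandVar hn hm]
  exact norm_prod_bernoulliCharFun_sub_le (bernoulliParam_mem n m k)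
    (ha.summandVariance_eq_sum hn hm k) hk hk1

theorem mainTheorem1 (n m : ℕ) (hn : 1 ≤ n) (hm : 1 ≤ m) (a : ℕ → ℕ)
    (ha : IsBinSequence n m a) :
    0 < meanConst n m ∧ 0 < varianceConst n m ∧
    (fun k : ℕ => summandMean n m a k - meanConst n m * (k : ℝ))
      =O[atTop] (fun _ : ℕ => (1 : ℝ)) ∧
    (fun k : ℕ => summandVariance n m a k - varianceConst n m * (k : ℝ))
      =O[atTop] (fun _ : ℕ => (1 : ℝ)) ∧
    (haveI : ∀ k : ℕ, IsProbabilityMeasure (uniformLaw n m a k) :=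
      ha.isProbabilityMeasure_uniformLaw
    TendstoInDistribution (fun k : ℕ => normalizedSummandVar n m a k) atTop
      (id : ℝ → ℝ) (fun k : ℕ => uniformLaw n m a k) (gaussianReal 0 1)) := by
  refine ⟨meanConst_pos hn, varianceConst_pos hn, ?_, ha.isBigO_summandVariance_sub hn, ?_⟩
  · exact (isBigO_tiltedMean_sub hn).congr_left fun k => by
      rw [ha.summandMean_eq_tiltedMean hn]
  · have : ∀ k : ℕ, IsProbabilityMeasure (uniformLaw n m a k) :=
      ha.isProbabilityMeasure_uniformLaw
    refine ⟨fun k => (measurable_of_countable _).aemeasurable, aemeasurable_id, ?_⟩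
    -- Lévy's continuity theorem.
    refine ProbabilityMeasure.tendsto_iff_tendsto_charFun.2 fun u => ?_
    simpa [charFun_gaussianReal] using ha.tendsto_charFun hn hm u
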